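/- Let $L$ be a completely regular frame, i.e. $a=\bigvee\{x\in L: x\prec\!\!\prec a\}$ for every $a\in L$. Here $x\prec y$ means $x^*\vee y=1$, and $x\prec\!\!\prec y$ means that there is a family $(c_q)_{q\in\mathbb{Q}\cap[0,1]}$ in $L$ with $c_0=x$, $c_1=y$ and $c_p\prec c_q$ whenever $p<q$. Let $\mathcal{R}L$ be the commutative ring of frame homomorphisms $\alpha:\mathfrak{O}(\mathbb{R})\to L$, with $(\alpha\diamond\beta)(W)=\bigvee\{\alpha(U)\wedge\beta(V): U\diamond V\subseteq W\}$ for $\diamond\in\{+,\cdot\}$. For $r\in\mathbb{R}$ let $\mathbf{r}\in\mathcal{R}L$ be the constant with $\mathbf{r}(U)=1$ if $r\in U$ and $\mathbf{r}(U)=0$ otherwise. Put $\operatorname{coz}\alpha=\alpha(-\infty,0)\vee\alpha(0,\infty)$ and $R_\alpha=\{r\in\mathbb{R}:\operatorname{coz}(\alpha-\mathbf{r})\neq 1\}$, and let $$\mathcal{R}_cL=\{\alpha\in\mathcal{R}L: R_\alpha\text{ is countable}\}.$$ Assume that $\mathcal{R}_cL$ is a subring of $\mathcal{R}L$. An ideal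 $Q$ of $\mathcal{R}_cL$ is called a $z_c$-ideal if $\alpha\in\mathcal{R}_cL$, $\beta\in Q$ and $\operatorname{coz}\alpha=\operatorname{coz}\beta$ imply $\alpha\in Q$. An ideal $A$ of a commutative ring is called a $z$-ideal if, whenever two elements of the ring belong to the same maximal ideals and one of them belongs to $A$, so does the other. Then an ideal $P$ of $\mathcal{R}_cL$ is a prime $z_c$-ideal if and only if $P=H\cap\mathcal{R}_cL$ for some prime $z$-ideal $H$ of $\mathcal{R}L$. -/

import Mathlib

open TopologicalSpace

noncomputable section

namespace Pointfree

/-! ### Completely regular frames -/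

section Regularity

variable {L : Type*} [Order.Frame L]

/-- `a ≺ b`: the element `a` is rather below `b`, i.e. `a* ∨ b = 1`. -/
def RatherBelow (a b : L) : Prop := aᶜ ⊔ b = ⊤

/-- `a ≺≺ b`: there is a family `(c q)`, indexed by the rationals of `[0, 1]`, with `c 0 = a`,
`c 1 = b` and `c p ≺ c q` whenever `p < q`. -/
def CompletelyBelow (a b : L) : Prop :=
  ∃ c : Set.Icc (0 : ℚ) 1 → L, c 0 = a ∧ c 1 = b ∧ ∀ p q, p < q → RatherBelow (c p) (c q)

variable (L) in
/-- Every element is the join of the elements completely below it. -/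
def IsCompletelyRegularFrame : Prop := ∀ a : L, a = sSup {x : L | CompletelyBelow x a}

end Regularity

/-! ### The ring of continuous real-valued functions on a frame -/

/-- The elements of `𝓡L`: frame homomorphisms from the frame of reals to `L`. The frame of reals
is realised as the frame of open sets of the real line. -/
abbrev RealFun (L : Type*) [Order.Frame L] := FrameHom (Opens ℝ) L

section Pairing

variable {L : Type*} [Order.Frame L]
variable {X Y Z : Type*} [TopologicalSpace X] [TopologicalSpace Y] [TopologicalSpace Z]

/-- The value at the open set `W ⊆ X × Y` of the pairing of `α` and `β`. -/
def pairFun (α : FrameHom (Opens X) L) (β : FrameHom (Opens Y) L) (W : Opens (X × Y)) : L :=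
  ⨆ (U : Opens X) (V : Opens Y) (_ : ∀ x ∈ U, ∀ y ∈ V, (x, y) ∈ W), α U ⊓ β V

theorem le_pairFun (α : FrameHom (Opens X) L) (β : FrameHom (Opens Y) L) {W : Opens (X × Y)}
    (U : Opens X) (V : Opens Y) (h : ∀ x ∈ U, ∀ y ∈ V, (x, y) ∈ W) :
    α U ⊓ β V ≤ pairFun α β W :=
  le_iSup_of_le U (le_iSup_of_le V (le_iSup_of_le h le_rfl))

theorem pairFun_le (α : FrameHom (Opens X) L) (β : FrameHom (Opens Y) L) {W : Opens (X × Y)}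
    {t : L} (h : ∀ (U : Opens X) (V : Opens Y), (∀ x ∈ U, ∀ y ∈ V, (x, y) ∈ W) → α U ⊓ β V ≤ t) :
    pairFun α β W ≤ t :=
  iSup_le fun U => iSup_le fun V => iSup_le fun hW => h U V hW

theorem pairFun_mono (α : FrameHom (Opens X) L) (β : FrameHom (Opens Y) L) {W W' : Opens (X × Y)}
    (h : W ≤ W') : pairFun α β W ≤ pairFun α β W' :=
  pairFun_le α β fun U V hW => le_pairFun α β U V fun x hx y hy => h (hW x hx y hy)

theorem le_of_locally_le (γ : FrameHom (Opens Z) L) (V : Opens Z) (t : L)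
    (h : ∀ z ∈ V, ∃ B : Opens Z, z ∈ B ∧ γ B ≤ t) : γ V ≤ t := by
  have hV : V ≤ sSup {B : Opens Z | γ B ≤ t} := by
    intro z hz
    obtain ⟨B, hB, hBt⟩ := h z hz
    exact (le_sSup (show B ∈ {B : Opens Z | γ B ≤ t} from hBt)) hB
  refine (OrderHomClass.mono γ hV).trans ?_
  rw [map_sSup]
  refine sSup_le ?_
  rintro _ ⟨B, hB, rfl⟩
  exact hB

theorem pairFun_sSup [LocallyCompactSpace X] (α : FrameHom (Opens X) L)
    (β : FrameHom (Opens Y) L) (S : Set (Opens (X × Y))) :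
    pairFun α β (sSup S) ≤ sSup (pairFun α β '' S) := by
  set t := sSup (pairFun α β '' S) with ht
  have hS : ∀ W ∈ S, pairFun α β W ≤ t := fun W hW => le_sSup ⟨W, hW, rfl⟩
  refine pairFun_le α β fun U V hUV => ?_
  have key : ∀ y ∈ V, ∀ K : Set X, IsCompact K → K ⊆ U →
      ∃ (A : Opens X) (B : Opens Y), K ⊆ A ∧ y ∈ B ∧ α A ⊓ β B ≤ t := by
    intro y hy K hK hKU
    refine hK.induction_on (p := fun s =>
      ∃ (A : Opens X) (B : Opens Y), s ⊆ A ∧ y ∈ B ∧ α A ⊓ β B ≤ t) ?_ ?_ ?_ ?_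
    · exact ⟨⊥, ⊤, Set.empty_subset _, trivial, by simp⟩
    · rintro s s' hs ⟨A, B, h1, h2, h3⟩
      exact ⟨A, B, hs.trans h1, h2, h3⟩
    · rintro s s' ⟨A, B, h1, h2, h3⟩ ⟨A', B', h1', h2', h3'⟩
      refine ⟨A ⊔ A', B ⊓ B', ?_, ⟨h2, h2'⟩, ?_⟩
      · rw [Opens.coe_sup]; exact Set.union_subset_union h1 h1'
      · rw [map_sup, map_inf, inf_sup_right]
        exact sup_le ((inf_le_inf_left _ inf_le_left).trans h3)
          ((inf_le_inf_left _ inf_le_right).trans h3')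
    · intro x hx
      obtain ⟨W, hWS, hW⟩ := Opens.mem_sSup.1 (hUV x (hKU hx) y hy)
      obtain ⟨A, B, hA, hB, hxA, hyB, hAB⟩ := isOpen_prod_iff.1 W.isOpen x y hW
      refine ⟨A, mem_nhdsWithin_of_mem_nhds (hA.mem_nhds hxA), ⟨A, hA⟩, ⟨B, hB⟩, le_rfl, hyB, ?_⟩
      exact (le_pairFun α β (W := W) ⟨A, hA⟩ ⟨B, hB⟩
        fun a ha b hb => hAB (Set.mk_mem_prod ha hb)).trans (hS W hWS)
  rw [← le_himp_iff]
  refine le_of_locally_le α U _ fun x hx => ?_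
  obtain ⟨K, hKx, hKU, hK⟩ := local_compact_nhds (U.isOpen.mem_nhds hx)
  refine ⟨⟨interior K, isOpen_interior⟩, mem_interior_iff_mem_nhds.2 hKx, ?_⟩
  rw [le_himp_iff, inf_comm, ← le_himp_iff]
  refine le_of_locally_le β V _ fun y hy => ?_
  obtain ⟨A, B, hKA, hyB, hAB⟩ := key y hy K hK hKU
  refine ⟨B, hyB, ?_⟩
  rw [le_himp_iff, inf_comm]
  exact (inf_le_inf_right _ (OrderHomClass.mono α
    (show (⟨interior K, isOpen_interior⟩ : Opens X) ≤ A from interior_subset.trans hKA))).trans hAB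

/-- The pairing of `α` and `β`: the frame homomorphism on the open sets of `X × Y` that restricts
to `α` and to `β` along the two projections. -/
def pair [LocallyCompactSpace X] (α : FrameHom (Opens X) L) (β : FrameHom (Opens Y) L) :
    FrameHom (Opens (X × Y)) L where
  toFun := pairFun α β
  map_inf' W W' := by
    apply le_antisymm
    · exact le_inf (pairFun_mono α β inf_le_left) (pairFun_mono α β inf_le_right)
    · rw [← le_himp_iff]
      refine pairFun_le α β fun U V hUV => ?_
      rw [le_himp_iff, inf_comm, ← le_himp_iff]
      refine pairFun_le α β fun U' V' hUV' => ?_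
      rw [le_himp_iff]
      refine le_trans (le_of_eq ?_) (le_pairFun α β (U ⊓ U') (V ⊓ V')
        fun x hx y hy => ⟨hUV x hx.1 y hy.1, hUV' x hx.2 y hy.2⟩)
      rw [map_inf, map_inf, inf_comm (α U' ⊓ β V'), inf_inf_inf_comm]
  map_top' := top_le_iff.1 <| by
    simpa using le_pairFun α β (W := ⊤) ⊤ ⊤ fun _ _ _ _ => trivial
  map_sSup' S := le_antisymm (pairFun_sSup α β S) <| sSup_le <| by
    rintro _ ⟨W, hW, rfl⟩
    exact pairFun_mono α β (le_sSup hW)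

theorem pair_apply [LocallyCompactSpace X] (α : FrameHom (Opens X) L) (β : FrameHom (Opens Y) L)
    (W : Opens (X × Y)) : pair α β W =
      ⨆ (U : Opens X) (V : Opens Y) (_ : ∀ x ∈ U, ∀ y ∈ V, (x, y) ∈ W), α U ⊓ β V := rfl

theorem pair_comap [LocallyCompactSpace X] (F : FrameHom (Opens Z) L) (f : C(Z, X)) (g : C(Z, Y)) :
    pair (F.comp (Opens.comap f)) (F.comp (Opens.comap g)) =
      F.comp (Opens.comap (f.prodMk g)) := by
  ext W
  apply le_antisymm
  · refine pairFun_le _ _ fun U V hUV => ?_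
    change F _ ⊓ F _ ≤ F _
    rw [← map_inf]
    exact OrderHomClass.mono F fun z hz => hUV _ hz.1 _ hz.2
  · refine le_of_locally_le F _ _ fun z hz => ?_
    obtain ⟨A, B, hA, hB, hxA, hyB, hAB⟩ := isOpen_prod_iff.1 W.isOpen (f z) (g z) hz
    refine ⟨Opens.comap f ⟨A, hA⟩ ⊓ Opens.comap g ⟨B, hB⟩, ⟨hxA, hyB⟩, ?_⟩
    rw [map_inf]
    exact le_pairFun (F.comp (Opens.comap f)) (F.comp (Opens.comap g)) (W := W) ⟨A, hA⟩ ⟨B, hB⟩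
      fun a ha b hb => hAB (Set.mk_mem_prod ha hb)

theorem pair_fst [LocallyCompactSpace X] (α : FrameHom (Opens X) L) (β : FrameHom (Opens Y) L) :
    (pair α β).comp (Opens.comap ⟨Prod.fst, continuous_fst⟩) = α := by
  ext U
  apply le_antisymm
  · refine pairFun_le α β fun U' V hUV => ?_
    by_cases hV : ∃ y, y ∈ V
    · obtain ⟨y, hy⟩ := hV
      exact inf_le_left.trans (OrderHomClass.mono α fun x hx => hUV x hx y hy)
    · have : V = ⊥ := Opens.ext (Set.eq_empty_iff_forall_notMem.2 fun y hy => hV ⟨y, hy⟩)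
      simp [this]
  · have h := le_pairFun α β (W := Opens.comap ⟨Prod.fst, continuous_fst⟩ U) U ⊤
      fun x hx y _ => hx
    rwa [map_top, inf_top_eq] at h

theorem pair_snd [LocallyCompactSpace X] (α : FrameHom (Opens X) L) (β : FrameHom (Opens Y) L) :
    (pair α β).comp (Opens.comap ⟨Prod.snd, continuous_snd⟩) = β := by
  ext V
  apply le_antisymm
  · refine pairFun_le α β fun U V' hUV => ?_
    by_cases hU : ∃ x, x ∈ U
    · obtain ⟨x, hx⟩ := hU
      exact inf_le_right.trans (OrderHomClass.mono β fun y hy => hUV x hx y hy)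
    · have : U = ⊥ := Opens.ext (Set.eq_empty_iff_forall_notMem.2 fun x hx => hU ⟨x, hx⟩)
      simp [this]
  · have h := le_pairFun α β (W := Opens.comap ⟨Prod.snd, continuous_snd⟩ V) ⊤ V
      fun x _ y hy => hy
    rwa [map_top, top_inf_eq] at h

end Pairing

namespace RealFun

variable {L : Type*} [Order.Frame L]

/-- The constant function `𝐫`: it sends `U` to `1` if `r ∈ U` and to `0` otherwise. -/
def const (r : ℝ) : RealFun L where
  toFun U := ⨆ _ : r ∈ U, ⊤
  map_inf' U V := by
    by_cases hU : r ∈ U <;> by_cases hV : r ∈ V <;> simp [hU, hV]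
  map_top' := by simp
  map_sSup' S := by
    apply le_antisymm
    · refine iSup_le fun h => ?_
      obtain ⟨U, hU, hr⟩ := Opens.mem_sSup.1 h
      exact le_sSup_of_le ⟨U, hU, rfl⟩ (by simp [hr])
    · refine sSup_le ?_
      rintro _ ⟨U, hU, rfl⟩
      refine iSup_le fun h => ?_
      simp [Opens.mem_sSup.2 ⟨U, hU, h⟩]

instance : Zero (RealFun L) := ⟨const 0⟩

instance : One (RealFun L) := ⟨const 1⟩

/-- `(-α)(U) = α(-U)`. -/
instance : Neg (RealFun L) := ⟨fun α => α.comp (Opens.comap ⟨fun x => -x, continuous_neg⟩)⟩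

/-- `(α + β)(W)` is the join of the `α(U) ∧ β(V)` with `U + V ⊆ W`. -/
instance : Add (RealFun L) :=
  ⟨fun α β => (pair α β).comp (Opens.comap ⟨fun p : ℝ × ℝ => p.1 + p.2, by fun_prop⟩)⟩

/-- `(α β)(W)` is the join of the `α(U) ∧ β(V)` with `U V ⊆ W`. -/
instance : Mul (RealFun L) :=
  ⟨fun α β => (pair α β).comp (Opens.comap ⟨fun p : ℝ × ℝ => p.1 * p.2, by fun_prop⟩)⟩

theorem add_apply (α β : RealFun L) (W : Opens ℝ) : (α + β) W =
    ⨆ (U : Opens ℝ) (V : Opens ℝ) (_ : ∀ x ∈ U, ∀ y ∈ V, x + y ∈ W), α U ⊓ β V := rfl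

theorem mul_apply (α β : RealFun L) (W : Opens ℝ) : (α * β) W =
    ⨆ (U : Opens ℝ) (V : Opens ℝ) (_ : ∀ x ∈ U, ∀ y ∈ V, x * y ∈ W), α U ⊓ β V := rfl

section Comap

variable {Z : Type*} [TopologicalSpace Z] (F : FrameHom (Opens Z) L)

/-- The element of `𝓡L` obtained from a continuous function on a space `Z` and a frame
homomorphism from the open sets of `Z` to `L`. -/
def pull (f : C(Z, ℝ)) : RealFun L := F.comp (Opens.comap f)

theorem pull_const (r : ℝ) : pull F (ContinuousMap.const Z r) = const r := by
  ext U
  change F (Opens.comap (ContinuousMap.const Z r) U) = ⨆ _ : r ∈ U, ⊤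
  by_cases h : r ∈ U
  · have hU : Opens.comap (ContinuousMap.const Z r) U = ⊤ :=
      Opens.ext (Set.eq_univ_of_forall fun _ => h)
    rw [hU, map_top, iSup_pos h]
  · have hU : Opens.comap (ContinuousMap.const Z r) U = ⊥ :=
      Opens.ext (Set.eq_empty_of_forall_notMem fun _ hz => h hz)
    rw [hU, map_bot, iSup_neg h]

theorem zero_eq_pull : (0 : RealFun L) = pull F 0 := (pull_const F 0).symm

theorem one_eq_pull : (1 : RealFun L) = pull F 1 := (pull_const F 1).symm

theorem pull_neg (f : C(Z, ℝ)) : -pull F f = pull F (-f) := rfl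

theorem pull_add (f g : C(Z, ℝ)) : pull F f + pull F g = pull F (f + g) :=
  congrArg (fun G : FrameHom (Opens (ℝ × ℝ)) L =>
    G.comp (Opens.comap ⟨fun p : ℝ × ℝ => p.1 + p.2, by fun_prop⟩)) (pair_comap F f g)

theorem pull_mul (f g : C(Z, ℝ)) : pull F f * pull F g = pull F (f * g) :=
  congrArg (fun G : FrameHom (Opens (ℝ × ℝ)) L =>
    G.comp (Opens.comap ⟨fun p : ℝ × ℝ => p.1 * p.2, by fun_prop⟩)) (pair_comap F f g)

end Comap

theorem exists_pull (α β γ : RealFun L) : ∃ (F : FrameHom (Opens (ℝ × ℝ × ℝ)) L)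
    (f g h : C(ℝ × ℝ × ℝ, ℝ)), α = pull F f ∧ β = pull F g ∧ γ = pull F h := by
  let s : C(ℝ × ℝ × ℝ, ℝ × ℝ) := ⟨Prod.snd, continuous_snd⟩
  have hs : (pair α (pair β γ)).comp (Opens.comap s) = pair β γ := pair_snd α (pair β γ)
  refine ⟨pair α (pair β γ), ⟨Prod.fst, continuous_fst⟩,
    (⟨Prod.fst, continuous_fst⟩ : C(ℝ × ℝ, ℝ)).comp s,
    (⟨Prod.snd, continuous_snd⟩ : C(ℝ × ℝ, ℝ)).comp s,
    (pair_fst α (pair β γ)).symm, ?_, ?_⟩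
  · conv_lhs => rw [← pair_fst β γ, ← hs]
    rfl
  · conv_lhs => rw [← pair_snd β γ, ← hs]
    rfl

/-- The commutative ring `𝓡L`. -/
instance : CommRing (RealFun L) where
  add_assoc α β γ := by
    obtain ⟨F, f, g, h, rfl, rfl, rfl⟩ := exists_pull α β γ
    simp only [pull_add, add_assoc]
  zero_add α := by
    obtain ⟨F, f, -, -, rfl, -, -⟩ := exists_pull α α α
    rw [zero_eq_pull F, pull_add, zero_add]
  add_zero α := by
    obtain ⟨F, f, -, -, rfl, -, -⟩ := exists_pull α α α
    rw [zero_eq_pull F, pull_add, add_zero]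
  add_comm α β := by
    obtain ⟨F, f, g, -, rfl, rfl, -⟩ := exists_pull α β α
    rw [pull_add, pull_add, add_comm]
  neg_add_cancel α := by
    obtain ⟨F, f, -, -, rfl, -, -⟩ := exists_pull α α α
    rw [zero_eq_pull F, pull_neg, pull_add, neg_add_cancel]
  mul_assoc α β γ := by
    obtain ⟨F, f, g, h, rfl, rfl, rfl⟩ := exists_pull α β γ
    simp only [pull_mul, mul_assoc]
  one_mul α := by
    obtain ⟨F, f, -, -, rfl, -, -⟩ := exists_pull α α α
    rw [one_eq_pull F, pull_mul, one_mul]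
  mul_one α := by
    obtain ⟨F, f, -, -, rfl, -, -⟩ := exists_pull α α α
    rw [one_eq_pull F, pull_mul, mul_one]
  mul_comm α β := by
    obtain ⟨F, f, g, -, rfl, rfl, -⟩ := exists_pull α β α
    rw [pull_mul, pull_mul, mul_comm]
  left_distrib α β γ := by
    obtain ⟨F, f, g, h, rfl, rfl, rfl⟩ := exists_pull α β γ
    simp only [pull_mul, pull_add, mul_add]
  right_distrib α β γ := by
    obtain ⟨F, f, g, h, rfl, rfl, rfl⟩ := exists_pull α β γ
    simp only [pull_mul, pull_add, add_mul]
  zero_mul α := by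
    obtain ⟨F, f, -, -, rfl, -, -⟩ := exists_pull α α α
    rw [zero_eq_pull F, pull_mul, zero_mul]
  mul_zero α := by
    obtain ⟨F, f, -, -, rfl, -, -⟩ := exists_pull α α α
    rw [zero_eq_pull F, pull_mul, mul_zero]
  nsmul := nsmulRec
  zsmul := zsmulRec

/-- The cozero element `coz α = α(-∞, 0) ∨ α(0, ∞)`. -/
def coz (α : RealFun L) : L := α ⟨Set.Iio 0, isOpen_Iio⟩ ⊔ α ⟨Set.Ioi 0, isOpen_Ioi⟩

/-- The pointfree image `R_α = {r ∈ ℝ | coz (α - 𝐫) ≠ 1}`. -/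
def image (α : RealFun L) : Set ℝ := {r : ℝ | coz (α - const r) ≠ ⊤}

/-- `α` has a countable pointfree image. -/
def HasCountableImage (α : RealFun L) : Prop := (image α).Countable

end RealFun

/-! ### `z`-ideals and `z_c`-ideals -/

/-- `A` is a `z`-ideal of `R`: if two elements of `R` lie in the same maximal ideals and one of them
is in `A`, then so is the other. -/
def IsZIdeal {R : Type*} [CommRing R] (A : Ideal R) : Prop :=
  ∀ a b : R, (∀ M : Ideal R, M.IsMaximal → (a ∈ M ↔ b ∈ M)) → a ∈ A → b ∈ A

/-- `Q` is a `z_c`-ideal of the subring `S` of `𝓡L`: if `coz α = coz β` with `α ∈ S` and `β ∈ Q`,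
then `α ∈ Q`. -/
def IsZcIdeal {L : Type*} [Order.Frame L] {S : Subring (RealFun L)} (Q : Ideal S) : Prop :=
  ∀ α β : S, RealFun.coz (α : RealFun L) = RealFun.coz (β : RealFun L) → β ∈ Q → α ∈ Q

end Pointfree

end

namespace Pointfree

namespace RealFun

open TopologicalSpace

variable {L : Type*} [Order.Frame L]

/-! ### Calculus of cozero elements. -/

section CozPull

variable {Z : Type*} [TopologicalSpace Z] (F : FrameHom (Opens Z) L)

/-! In the full ring, maximal ideals see exactly the order of cozero elements: `coz α ≤ coz β` if
and only if every maximal ideal containing `β` contains `α` (`mem_of_coz_le`,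
`coz_le_of_forall_isMaximal`). Hence the z-ideals there are the ideals closed under equality of
cozero elements, and contracting a prime one gives a prime z_c-ideal.

Conversely, a z_c-ideal `P` is the trace of the ideal `cozHull P`. If `P` is prime, its complement
is multiplicative and misses `cozHull P`, so some prime over `cozHull P` avoids it. A minimal prime
over `cozHull P` below that one still contracts to `P`, and minimality makes it a z-ideal.

Identities for `coz` are checked pointwise: `exists_pull` turns given elements into continuous
functions on one space. -/

theorem coz_pull (f : C(Z, ℝ)) :
    coz (pull F f) = F ⟨{z | f z ≠ 0}, isOpen_ne_fun f.continuous continuous_const⟩ := by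
  change F _ ⊔ F _ = F _
  rw [← map_sup]
  congr 1
  ext z
  exact (ne_iff_lt_or_gt (a := f z) (b := 0)).symm

end CozPull

theorem coz_one : coz (1 : RealFun L) = ⊤ := by
  rw [one_eq_pull (0 : RealFun L), coz_pull, ← map_top (0 : RealFun L)]
  congr 1
  ext z
  simp

theorem coz_add_le (α β : RealFun L) : coz (α + β) ≤ coz α ⊔ coz β := by
  obtain ⟨F, f, g, -, rfl, rfl, -⟩ := exists_pull α β α
  rw [pull_add, coz_pull, coz_pull, coz_pull, ← map_sup]
  refine OrderHomClass.mono F fun z hz => ?_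
  by_contra h
  have h' : ¬ (f z ≠ 0 ∨ g z ≠ 0) := h
  push Not at h'
  exact hz (by simp [h'.1, h'.2])

theorem coz_mul (α β : RealFun L) : coz (α * β) = coz α ⊓ coz β := by
  obtain ⟨F, f, g, -, rfl, rfl, -⟩ := exists_pull α β α
  rw [pull_mul, coz_pull, coz_pull, coz_pull, ← map_inf]
  congr 1
  ext z
  exact mul_ne_zero_iff

/-- Only an inequality, because the exponent `0` gives `⊤`. -/
theorem coz_le_coz_pow (α : RealFun L) (n : ℕ) : coz α ≤ coz (α ^ n) := by
  induction n with
  | zero => rw [pow_zero, coz_one]; exact le_top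
  | succ n ih => rw [pow_succ, coz_mul]; exact le_inf ih le_rfl

/-- A sum of two real squares vanishes only if both terms do. Thus any ideal realises the join of
the cozero elements of two members. -/
theorem coz_mul_self_add_mul_self (α β : RealFun L) :
    coz (α * α + β * β) = coz α ⊔ coz β := by
  obtain ⟨F, f, g, -, rfl, rfl, -⟩ := exists_pull α β α
  rw [pull_mul, pull_mul, pull_add, coz_pull, coz_pull, coz_pull, ← map_sup]
  congr 1
  ext z
  change f z * f z + g z * g z ≠ 0 ↔ (f z ≠ 0 ∨ g z ≠ 0)
  rw [Ne, mul_self_add_mul_self_eq_zero, not_and_or]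

/-! ### Units and maximal ideals. -/

/-- A homomorphism that sends an open set `A` to `⊤` factors through the open subspace `A`. -/
def restrict {Z : Type*} [TopologicalSpace Z] (F : FrameHom (Opens Z) L) (A : Opens Z)
    (hA : F A = ⊤) : FrameHom (Opens A) L where
  toFun V := F ⟨Subtype.val '' (V : Set A), A.isOpen.isOpenMap_subtype_val _ V.isOpen⟩
  map_inf' V W := by
    rw [← map_inf]
    congr 1
    ext z
    simp only [Opens.coe_inf, Set.image_inter Subtype.val_injective, Opens.coe_mk]
  map_top' := by
    rw [← hA]
    congr 1
    ext z
    simp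
  map_sSup' S := by
    refine le_antisymm (le_of_locally_le F _ _ ?_) (sSup_le ?_)
    · rintro _ ⟨z, hz, rfl⟩
      obtain ⟨V, hV, hzV⟩ := Opens.mem_sSup.1 hz
      exact ⟨_, Set.mem_image_of_mem _ hzV, le_sSup ⟨V, hV, rfl⟩⟩
    · rintro _ ⟨V, hV, rfl⟩
      exact OrderHomClass.mono F (Set.image_mono (show V ≤ sSup S from le_sSup hV))

theorem restrict_comp_comap {Z : Type*} [TopologicalSpace Z] (F : FrameHom (Opens Z) L)
    (A : Opens Z) (hA : F A = ⊤) :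
    (restrict F A hA).comp (Opens.comap ⟨Subtype.val, continuous_subtype_val⟩) = F := by
  ext U
  have h : F U = F (U ⊓ A) := by rw [map_inf, hA, inf_top_eq]
  rw [h]
  change F _ = F _
  congr 1
  ext z
  constructor
  · rintro ⟨w, hw, rfl⟩
    exact ⟨hw, w.2⟩
  · exact fun hz => ⟨⟨z, hz.2⟩, hz.1, rfl⟩

/-- Such an `α` factors through the nonzero reals, where inversion is continuous and can be pulled
back. -/
theorem isUnit_of_coz_eq_top {α : RealFun L} (h : coz α = ⊤) : IsUnit α := by
  let A : Opens ℝ := ⟨{x | x ≠ 0}, isOpen_ne⟩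
  have hA : α A = ⊤ := by
    rw [← h, coz, ← map_sup]
    congr 1
    ext x
    exact ne_iff_lt_or_gt
  let i : C(A, ℝ) := ⟨Subtype.val, continuous_subtype_val⟩
  let j : C(A, ℝ) := ⟨fun x => (x : ℝ)⁻¹, continuous_subtype_val.inv₀ fun x => x.2⟩
  have hα : α = pull (restrict α A hA) i := (restrict_comp_comap α A hA).symm
  have hij : i * j = 1 := by
    ext x
    exact mul_inv_cancel₀ x.2
  refine IsUnit.of_mul_eq_one (pull (restrict α A hA) j) ?_
  calc
    _ = pull (restrict α A hA) i * pull (restrict α A hA) j := congrArg (· * _) hα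
    _ = 1 := by rw [pull_mul, hij, ← one_eq_pull]

theorem coz_sup_ne_top_of_mem {M : Ideal (RealFun L)} (hM : M ≠ ⊤) {α β : RealFun L}
    (hα : α ∈ M) (hβ : β ∈ M) : coz α ⊔ coz β ≠ ⊤ := by
  intro h
  rw [← coz_mul_self_add_mul_self] at h
  exact hM (M.eq_top_of_isUnit_mem (M.add_mem (M.mul_mem_left _ hα) (M.mul_mem_left _ hβ))
    (isUnit_of_coz_eq_top h))

/-- If `α ∉ M`, then `γ * α + δ = 1` with `δ ∈ M`, so the cozero elements of `β` and `δ`, both in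
`M`, would cover `⊤`. -/
theorem mem_of_coz_le {M : Ideal (RealFun L)} (hM : M.IsMaximal) {α β : RealFun L}
    (h : coz α ≤ coz β) (hβ : β ∈ M) : α ∈ M := by
  by_contra hα
  obtain ⟨γ, δ, hδ, h1⟩ := hM.exists_inv hα
  refine coz_sup_ne_top_of_mem hM.ne_top hβ hδ (top_le_iff.1 ?_)
  rw [← coz_one, ← h1]
  refine (coz_add_le _ _).trans (sup_le_sup_right ?_ _)
  rw [coz_mul]
  exact inf_le_right.trans h

theorem coz_le_of_forall_isMaximal {α β : RealFun L}
    (h : ∀ M : Ideal (RealFun L), M.IsMaximal → β ∈ M → α ∈ M) : coz α ≤ coz β := by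
  have hα : α = pull α (ContinuousMap.id ℝ) := rfl
  have key : ∀ r : ℝ, 0 < r → α ⟨{x | r < |x|}, isOpen_lt continuous_const continuous_abs⟩ ≤
      coz β := by
    intro r hr
    -- A bump at `0` with cozero set `|x| < r`. A maximal ideal containing `β` and `pull α g` would
    -- contain `α` too, yet `x ≠ 0` and `|x| < r` cover the line.
    let g : C(ℝ, ℝ) := ⟨fun x => max 0 (r - |x|), by fun_prop⟩
    have hg : coz (pull α g) = α ⟨{x | |x| < r}, isOpen_lt continuous_abs continuous_const⟩ := by
      rw [coz_pull]
      congr 1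
      ext x
      change max 0 (r - |x|) ≠ 0 ↔ |x| < r
      rw [Ne, max_eq_left_iff, not_le, sub_pos]
    have htop : Ideal.span {β, pull α g} = ⊤ := by
      by_contra hne
      obtain ⟨M, hM, hle⟩ := Ideal.exists_le_maximal _ hne
      have hβ : β ∈ M := hle (Ideal.subset_span (by simp))
      have hgM : pull α g ∈ M := hle (Ideal.subset_span (by simp))
      refine coz_sup_ne_top_of_mem hM.ne_top (h M hM hβ) hgM ?_
      rw [hg, hα, coz_pull]
      change α _ ⊔ α _ = ⊤
      rw [← map_sup, ← map_top α]
      congr 1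
      refine Opens.ext (Set.eq_univ_of_forall fun x => ?_)
      change x ≠ 0 ∨ |x| < r
      by_cases hx : x = 0
      · exact Or.inr (by simpa [hx] using hr)
      · exact Or.inl hx
    obtain ⟨a, b, hab⟩ := Ideal.mem_span_pair.1 (htop ▸ Submodule.mem_top : (1 : RealFun L) ∈ _)
    have hcov : coz β ⊔ coz (pull α g) = ⊤ := by
      rw [← top_le_iff, ← coz_one, ← hab]
      refine (coz_add_le _ _).trans (sup_le_sup ?_ ?_) <;>
      · rw [coz_mul]
        exact inf_le_right
    -- The part `r < |x|` misses `coz (pull α g)`, which together with `coz β` covers `⊤`; so it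
    -- lies below `coz β`.
    refine Disjoint.le_of_codisjoint (b := coz (pull α g)) ?_ (codisjoint_iff.2 hcov).symm
    rw [disjoint_iff, hg, ← map_inf, ← map_bot α]
    congr 1
    refine Opens.ext (Set.eq_empty_of_forall_notMem fun x hx => ?_)
    exact lt_asymm (show |x| < r from hx.2) hx.1
  conv_lhs => rw [hα, coz_pull]
  refine le_of_locally_le α _ _ fun x hx => ⟨_, ?_, key (|x| / 2) (half_pos (abs_pos.2 hx))⟩
  exact half_lt_self (abs_pos.2 hx)

end RealFun

open RealFun

variable {L : Type*} [Order.Frame L]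

/-! ### z-ideals via cozero elements, and minimal primes. -/

theorem isZIdeal_iff_coz {A : Ideal (RealFun L)} :
    IsZIdeal A ↔ ∀ α β : RealFun L, coz α = coz β → α ∈ A → β ∈ A :=
  ⟨fun h α β hαβ => h α β fun _ hM => ⟨mem_of_coz_le hM hαβ.ge, mem_of_coz_le hM hαβ.le⟩,
    fun h α β hM => h α β (le_antisymm
      (coz_le_of_forall_isMaximal fun M hm => (hM M hm).2)
      (coz_le_of_forall_isMaximal fun M hm => (hM M hm).1))⟩

/-- The functions whose cozero element lies below that of a member of `P`. -/
def cozHull {S : Subring (RealFun L)} (P : Ideal S) : Ideal (RealFun L) where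
  carrier := {α | ∃ β ∈ P, coz α ≤ coz (β : RealFun L)}
  add_mem' := by
    rintro α α' ⟨β, hβ, h⟩ ⟨β', hβ', h'⟩
    refine ⟨β * β + β' * β', P.add_mem (P.mul_mem_left _ hβ) (P.mul_mem_left _ hβ'), ?_⟩
    refine (coz_add_le α α').trans ((sup_le_sup h h').trans ?_)
    exact (coz_mul_self_add_mul_self (β : RealFun L) β').ge
  zero_mem' := ⟨0, P.zero_mem, le_rfl⟩
  smul_mem' γ α := by
    rintro ⟨β, hβ, h⟩
    refine ⟨β, hβ, ?_⟩
    rw [smul_eq_mul, coz_mul]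
    exact inf_le_right.trans h

theorem mem_cozHull_of_coz_le {S : Subring (RealFun L)} {P : Ideal S} {α β : RealFun L}
    (h : coz α ≤ coz β) : β ∈ cozHull P → α ∈ cozHull P := by
  rintro ⟨γ, hγ, hβ⟩
  exact ⟨γ, hγ, h.trans hβ⟩

/-- If `coz α ≤ coz β` with `β ∈ P`, then `α * β` is a member of `P` with the same cozero element as
`α`. -/
theorem coe_mem_cozHull_iff {S : Subring (RealFun L)} {P : Ideal S}
    (hz : IsZcIdeal P) (α : S) : (α : RealFun L) ∈ cozHull P ↔ α ∈ P := by
  refine ⟨?_, fun h => ⟨α, h, le_rfl⟩⟩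
  rintro ⟨β, hβ, h⟩
  refine hz α (α * β) ?_ (P.mul_mem_left α hβ)
  rw [Subring.coe_mul, coz_mul, inf_eq_left.2 h]

/-- By minimality, each `α ∈ H` has some `y ∉ H` and `n` with `y * α ^ n` in the hull; otherwise a
prime over the hull, inside `H`, would omit `α`. Replacing `α ^ n` by `β` with `coz β = coz α` keeps
the product in the hull, so `β ∈ H`. -/
theorem isZIdeal_of_mem_minimalPrimes_cozHull {S : Subring (RealFun L)} {P : Ideal S}
    {H : Ideal (RealFun L)} (hH : H ∈ (cozHull P).minimalPrimes) : IsZIdeal H := by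
  rw [isZIdeal_iff_coz]
  intro α β h hα
  have hprime : H.IsPrime := hH.1.1
  by_contra hβ
  obtain ⟨x, hxI, hxS⟩ : ∃ x ∈ cozHull P, x ∈ H.primeCompl ⊔ Submonoid.powers α := by
    by_contra! hdisj
    obtain ⟨q, hq, hle, hqd⟩ := Ideal.exists_le_prime_disjoint (cozHull P)
      (H.primeCompl ⊔ Submonoid.powers α) (Set.disjoint_left.2 hdisj)
    have hqH : q ≤ H := fun x hx => by
      by_contra hxH
      exact Set.disjoint_left.1 hqd hx ((le_sup_left : H.primeCompl ≤ _) hxH)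
    exact Set.disjoint_left.1 hqd (hH.2 ⟨hq, hle⟩ hqH hα)
      ((le_sup_right : Submonoid.powers α ≤ _) (Submonoid.mem_powers α))
  obtain ⟨y, hy, _, ⟨n, rfl⟩, rfl⟩ := Submonoid.mem_sup.1 hxS
  refine (hprime.mem_or_mem (x := y) (y := β) (hH.1.2 (mem_cozHull_of_coz_le ?_ hxI))).elim hy hβ
  rw [coz_mul, coz_mul, ← h]
  exact inf_le_inf_left _ (coz_le_coz_pow α n)

end Pointfree

theorem corollary3p6 {L : Type*} [Order.Frame L] (hL : Pointfree.IsCompletelyRegularFrame L)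
    (RcL : Subring (Pointfree.RealFun L))
    (hRcL : ∀ α : Pointfree.RealFun L, α ∈ RcL ↔ Pointfree.RealFun.HasCountableImage α)
    (P : Ideal RcL) :
    (P.IsPrime ∧ Pointfree.IsZcIdeal P) ↔
      ∃ H : Ideal (Pointfree.RealFun L), H.IsPrime ∧ Pointfree.IsZIdeal H ∧
        H.comap RcL.subtype = P := by
  constructor
  · rintro ⟨hP, hz⟩
    have hdisj : Disjoint (Pointfree.cozHull P : Set (Pointfree.RealFun L))
        (P.primeCompl.map RcL.subtype : Submonoid (Pointfree.RealFun L)) := by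
      rw [Set.disjoint_left]
      rintro _ hα ⟨α, hαP, rfl⟩
      exact hαP ((Pointfree.coe_mem_cozHull_iff hz α).1 hα)
    obtain ⟨K, hK, hle, hKd⟩ := Ideal.exists_le_prime_disjoint _ _ hdisj
    -- Shrinking `K` preserves disjointness from the complement of `P`, and minimality supplies the
    -- z-property.
    obtain ⟨H, hH, hHK⟩ := Ideal.exists_minimalPrimes_le hle
    refine ⟨H, hH.1.1, Pointfree.isZIdeal_of_mem_minimalPrimes_cozHull hH, ?_⟩
    ext α
    refine ⟨fun h => ?_, fun h => hH.1.2 ((Pointfree.coe_mem_cozHull_iff hz α).2 h)⟩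
    by_contra hα
    exact Set.disjoint_left.1 hKd (hHK h) ⟨α, hα, rfl⟩
  · rintro ⟨H, hH, hz, rfl⟩
    exact ⟨hH.comap _, fun α β h hβ => Pointfree.isZIdeal_iff_coz.1 hz β α h.symm hβ⟩
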